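/- Let $t\ge 2$ be an integer and consider the Hamming space $\mathbb F_2^t$ of binary vectors of length $t$, with minimum distance $d=t-1$. Put $$c(t)=\begin{cases}2+\dfrac{2}{t-1}, & t \text{ even},\\[2mm] 2+\dfrac{2}{t-2}, & t\text{ odd}.\end{cases}$$ *Delsarte's LP.* For $\mathbf j,\mathbf k\in\{0,1\}^t$ let $Q_{\mathbf j\mathbf k}=\prod_{i=1}^t Q^{(i)}_{j_ik_i}$, where each $Q^{(i)}=\begin{pmatrix}1&1\\1&-1\end{pmatrix}$ is the second eigenmatrix of the scheme of $1\times 1$ matrices over $\mathbb F_2$. Delsarte's LP for minimum distance $d$ is: maximize $\sum_{\mathbf j}a_{\mathbf j}$ over real vectors $\mathbf a=(a_{\mathbf j})_{\mathbf j\in\{0,1\}^t}$ subject to $\mathbf aQ\ge \mathbf 0$, $\mathbf a\ge\mathbf 0$, $a_{(0,\dots,0)}=1$, and $a_{\mathbf j}=0$ whenever $0<\sum_i j_i<d$. *Ratio-type LP.* Let $\theta_0>\cdots>\theta_r$ be the distinct eigenvalues, with multiplicities $m(\theta_0),\dots,m(\theta_r)$, of the adjacency matrix of the Hamming graph $H(t,2)$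 (vertex set $\mathbb F_2^t$, two vectors being adjacent iff their Hamming distance is $1$). The Ratio-type LP for minimum distance $d$ is: minimize $\sum_{j=0}^r m(\theta_j)x_j$ over real $x_0,\dots,x_r$ subject to $x_0=1$, $x_j\ge0$ for $1\le j\le r$, and $f[\theta_0,\dots,\theta_s]=0$ for $s=d,\dots,r$, where the divided differences are defined by $f[\theta_i]=x_i$ and $f[\theta_i,\dots,\theta_j]=\dfrac{f[\theta_{i+1},\dots,\theta_j]-f[\theta_i,\dots,\theta_{j-1}]}{\theta_j-\theta_i}$ for $i<j$. Then for $d=t-1$ both linear programs attain their optima, and both optima are equal to $c(t)$. In particular, if $t\ge4$, then both LP bounds, rounded down to an integer, give the upper bound $\lfloor c(t)\rfloor=2$ on the size of a binary code of length $t$ with minimum distance $t-1$, while the Singleton bound $2^{t-d+1}$ gives $4$. -/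

import Mathlib

/-! ### The Hamming graph and its spectrum -/

/-- The Hamming graph `H(t,q)` on the vectors of length `t` over the alphabet `F`, `q = |F|`:
two vectors are adjacent iff their Hamming distance is exactly `1`. -/
def hammingGraph (t : ℕ) (F : Type*) [DecidableEq F] : SimpleGraph (Fin t → F) where
  Adj x y := hammingDist x y = 1
  symm := ⟨fun x y h => by rw [hammingDist_comm]; exact h⟩
  loopless := ⟨fun x h => by simp at h⟩

instance (t : ℕ) (F : Type*) [DecidableEq F] : DecidableRel (hammingGraph t F).Adj :=
  fun x y => inferInstanceAs (Decidable (hammingDist x y = 1))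

section Spectrum

variable {V : Type*} [Fintype V] [DecidableEq V] (G : SimpleGraph V) [DecidableRel G.Adj]

/-- The eigenvalues of the (real symmetric) adjacency matrix of `G`, with multiplicity. -/
noncomputable def adjEigenvalues : Multiset ℝ := (G.adjMatrix ℝ).charpoly.roots

/-- The number `r + 1` of distinct eigenvalues of `G`. -/
noncomputable def numDistinctEigenvalues : ℕ := (adjEigenvalues G).toFinset.card

/-- The `j`-th distinct eigenvalue `θ_j` of `G`, in decreasing order `θ_0 > θ_1 > ⋯ > θ_r`
(with the irrelevant value `0` for `j > r`). -/
noncomputable def distinctEigenvalue (j : ℕ) : ℝ :=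
  ((adjEigenvalues G).toFinset.sort (· ≥ ·)).getD j 0

/-- The multiplicity `m(θ)` of `θ` as an eigenvalue of `G`. -/
noncomputable def eigenvalueMultiplicity (θ : ℝ) : ℕ := (adjEigenvalues G).count θ

end Spectrum

/-! ### The Ratio-type LP -/

/-- `newtonDivDiff θ x i k` is the divided difference `f[θ_i, …, θ_{i+k}]` of the data
`f[θ_j] = x_j`. -/
noncomputable def newtonDivDiff (θ x : ℕ → ℝ) (i : ℕ) : ℕ → ℝ
  | 0 => x i
  | k + 1 => (newtonDivDiff θ x (i + 1) k - newtonDivDiff θ x i k) / (θ (i + (k + 1)) - θ i)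

/-- The feasible points of the Ratio-type LP of `G` for minimum distance `d`. The variables are
`x_0, …, x_r`, where `r + 1` is the number of distinct eigenvalues; other entries of `x` play no
role. -/
def RatioTypeFeasible {V : Type*} [Fintype V] [DecidableEq V] (G : SimpleGraph V)
    [DecidableRel G.Adj] (d : ℕ) (x : ℕ → ℝ) : Prop :=
  (∀ s, d ≤ s → s < numDistinctEigenvalues G → newtonDivDiff (distinctEigenvalue G) x 0 s = 0) ∧
  (∀ j, 1 ≤ j → j < numDistinctEigenvalues G → 0 ≤ x j) ∧
  x 0 = 1

/-- The objective `∑_{j=0}^r m(θ_j) x_j` (to be minimized) of the Ratio-type LP of `G`. -/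
noncomputable def ratioTypeObjective {V : Type*} [Fintype V] [DecidableEq V] (G : SimpleGraph V)
    [DecidableRel G.Adj] (x : ℕ → ℝ) : ℝ :=
  ∑ j ∈ Finset.range (numDistinctEigenvalues G),
    (eigenvalueMultiplicity G (distinctEigenvalue G j) : ℝ) * x j

/-- The set of values of the Ratio-type LP at its feasible points. -/
def ratioTypeValues {V : Type*} [Fintype V] [DecidableEq V] (G : SimpleGraph V)
    [DecidableRel G.Adj] (d : ℕ) : Set ℝ :=
  {z | ∃ x, RatioTypeFeasible G d x ∧ ratioTypeObjective G x = z}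

/-! ### Delsarte's LP -/

/-- The parameter `b_v` of the bilinear forms graph of `n × m` matrices over the field with `q`
elements (used for `v ≤ n ≤ m`). -/
noncomputable def bilB (q n m v : ℕ) : ℝ :=
  (q : ℝ) ^ (2 * v) * ((q : ℝ) ^ (m - v) - 1) * ((q : ℝ) ^ (n - v) - 1) / ((q : ℝ) - 1)

/-- The parameter `c_v` of the bilinear forms graph (used for `1 ≤ v`). -/
noncomputable def bilC (q v : ℕ) : ℝ :=
  (q : ℝ) ^ (v - 1) * ((q : ℝ) ^ v - 1) / ((q : ℝ) - 1)

/-- The parameter `a_v = b_0 - b_v - c_v` of the bilinear forms graph. -/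
noncomputable def bilA (q n m v : ℕ) : ℝ := bilB q n m 0 - bilB q n m v - bilC q v

/-- The eigenvalue `θ_u` of the bilinear forms graph (used for `u ≤ n ≤ m`). -/
noncomputable def bilEigenvalue (q n m u : ℕ) : ℝ :=
  (((q : ℝ) ^ (n - u) - 1) * ((q : ℝ) ^ m - (q : ℝ) ^ u) - (q : ℝ) ^ u + 1) / ((q : ℝ) - 1)

/-- The polynomials `p_v` given by the three-term recurrence
`c_v p_v(θ) = (θ - a_{v-1}) p_{v-1}(θ) - b_{v-2} p_{v-2}(θ)`, with `p_0 = 1` and `p_1 = θ`. -/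
noncomputable def bilPoly (q n m : ℕ) (θ : ℝ) : ℕ → ℝ
  | 0 => 1
  | 1 => θ
  | v + 2 => ((θ - bilA q n m (v + 1)) * bilPoly q n m θ (v + 1)
      - bilB q n m v * bilPoly q n m θ v) / bilC q (v + 2)

/-- The second eigenmatrix of the bilinear forms scheme of `n × m` matrices, `n ≤ m`. -/
noncomputable def bilSecondEigenmatrix (q n m : ℕ) : Matrix (Fin (n + 1)) (Fin (n + 1)) ℝ :=
  Matrix.of fun u v => bilPoly q n m (bilEigenvalue q n m u) v

/-- The second eigenmatrix `Q = Q⁽¹⁾ ⊗ ⋯ ⊗ Q⁽ᵗ⁾` of the sum-rank-metric scheme whose `i`-th block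
consists of the `n i × m i` matrices over the field with `q` elements. -/
noncomputable def sumRankSecondEigenmatrix (q : ℕ) {t : ℕ} (n m : Fin t → ℕ) :
    Matrix (∀ i, Fin (n i + 1)) (∀ i, Fin (n i + 1)) ℝ :=
  Matrix.of fun j k => ∏ i, bilSecondEigenmatrix q (n i) (m i) (j i) (k i)

/-- The feasible points of Delsarte's LP for minimum distance `d` in the sum-rank-metric space
with block sizes `n i × m i` over the field with `q` elements. -/
def DelsarteFeasible (q : ℕ) {t : ℕ} (n m : Fin t → ℕ) (d : ℕ)
    (a : (∀ i, Fin (n i + 1)) → ℝ) : Prop :=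
  (∀ k, 0 ≤ Matrix.vecMul a (sumRankSecondEigenmatrix q n m) k) ∧
  (∀ j, 0 ≤ a j) ∧
  a (fun _ => 0) = 1 ∧
  (∀ j : ∀ i, Fin (n i + 1), 0 < ∑ i, (j i : ℕ) → ∑ i, (j i : ℕ) < d → a j = 0)

/-- The set of values of the objective `∑_j a_j` (to be maximized) of Delsarte's LP at its
feasible points. -/
def delsarteValues (q : ℕ) {t : ℕ} (n m : Fin t → ℕ) (d : ℕ) : Set ℝ :=
  {z | ∃ a, DelsarteFeasible q n m d a ∧ ∑ j, a j = z}

/-- Delsarte's LP in the Hamming space of vectors of length `t` over the field with `q` elements,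
which is the sum-rank-metric space all of whose `t` blocks have size `1 × 1`. -/
def hammingDelsarteValues (q t d : ℕ) : Set ℝ :=
  delsarteValues q (fun _ : Fin t => 1) (fun _ : Fin t => 1) d

/-! ### The Singleton bound and the common optimum -/

/-- The Singleton bound `q^(t-d+1)` for codes of length `t` and minimum distance `d ≤ t` in the
Hamming metric over an alphabet of size `q`. -/
def hammingSingletonBound (q t d : ℕ) : ℕ := q ^ (t - d + 1)

/-- `c(t) = 2 + 2/(t-1)` for even `t` and `c(t) = 2 + 2/(t-2)` for odd `t`. -/
noncomputable def extremalLPValue (t : ℕ) : ℝ :=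
  if Even t then 2 + 2 / ((t : ℝ) - 1) else 2 + 2 / ((t : ℝ) - 2)

/-!
Both linear programs reduce to a problem in very few variables, solved by exhibiting a feasible
point and a dual certificate with the same value.

For Delsarte's LP, a feasible vector lives on weights `0`, `t - 1`, `t`. If `B` is its value at
the all-ones vector and `b i` its value at the vector whose only zero is at `i`, the constraint at
column `k` reads `1 + (-1) ^ |k| * (B + ∑ i, b i * (1 - 2 * k i)) ≥ 0` (`vecMul_eq_of_support`).
Combining the columns of weight `1` with those of the largest even weight bounds `1 + B + ∑ i, b i`
(`delsarte_sum_le`), and a vector depending only on the weight attains the bound.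

For the Ratio-type LP, the characters of `𝔽₂^t` diagonalize the adjacency matrix of the hypercube
(`adjMatrix_mul_cubeCharacter`), so the distinct eigenvalues are `t - 2 * j` with multiplicity
`t.choose j`. The nodes are equally spaced, hence divided differences are iterated forward
differences (`newtonDivDiff_eq_fwdDiff`), and with `y j = t.choose j * x j` the constraints become
`∑ (-1) ^ j * y j = 0` and `∑ (-1) ^ j * j * y j = 0`
(`ratioTypeFeasible_hammingGraph_iff`). Let `M` be the largest even number at most `t`. If `E` is
the sum of `y` over the even indices, equivalently over the odd ones, then
`E ≤ ∑_{j odd} j * y j = ∑_{j even} j * y j ≤ M * (E - 1)`, so that the objective `2 * E` is at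
least `2 * M / (M - 1) = 2 + 2 / (M - 1)`, with equality for `y` supported on `0, 1, M`
(`isLeast_ratioTypeValues_of_even`).
-/

/-! ### Delsarte's LP for minimum distance `t - 1` -/

theorem bilSecondEigenmatrix_two_one (j k : Fin 2) :
    bilSecondEigenmatrix 2 1 1 j k = if j = 1 then 1 - 2 * ((k : ℕ) : ℝ) else 1 := by
  fin_cases j <;> fin_cases k <;>
    simp [bilSecondEigenmatrix, bilPoly, bilEigenvalue] <;> norm_num

theorem neg_one_pow_fin_two (k : Fin 2) : (1 : ℝ) - 2 * ((k : ℕ) : ℝ) = (-1) ^ (k : ℕ) := by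
  fin_cases k <;> norm_num

theorem sum_coe_fin_two_eq_card {t : ℕ} (j : Fin t → Fin 2) :
    ∑ i, (j i : ℕ) = t - (Finset.univ.filter fun i => j i = 0).card := by
  have h : ∑ i, (j i : ℕ) + ∑ i, (if j i = 0 then 1 else 0) = t := by
    rw [← Finset.sum_add_distrib, Finset.sum_congr rfl (g := fun _ => 1)]
    · simp
    · intro i _
      generalize j i = b
      fin_cases b <;> rfl
  rw [Finset.card_filter]
  omega

/-- A function on `{0,1}^t` that vanishes at all weights strictly between `0` and `t - 1` is summed
over the zero vector, the all-ones vector, and the `t` vectors with exactly one zero. -/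
theorem sum_eq_of_support {t : ℕ} (ht : 2 ≤ t) (g : (Fin t → Fin 2) → ℝ)
    (hg : ∀ j, 0 < ∑ i, (j i : ℕ) → ∑ i, (j i : ℕ) < t - 1 → g j = 0) :
    ∑ j, g j = g (fun _ => 0) + g (fun _ => 1) + ∑ i, g (fun l => if l = i then 0 else 1) := by
  -- `e` lists the vectors of weight `0`, `t` and `t - 1`; distinctness uses `t ≥ 2`.
  let e : Option (Option (Fin t)) → (Fin t → Fin 2)
    | none => fun _ => 0
    | some none => fun _ => 1
    | some (some i) => fun l => if l = i then 0 else 1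
  have other : ∀ i : Fin t, ∃ l, l ≠ i := fun i =>
    have : Nontrivial (Fin t) := Fin.nontrivial_iff_two_le.2 ht
    exists_ne i
  have he : Function.Injective e := by
    rintro (_ | _ | i) (_ | _ | l) h
    · rfl
    · simpa [e] using congrFun h ⟨0, by omega⟩
    · obtain ⟨m, hm⟩ := other l
      simpa [e, hm] using congrFun h m
    · simpa [e] using congrFun h ⟨0, by omega⟩
    · rfl
    · simpa [e] using congrFun h l
    · obtain ⟨m, hm⟩ := other i
      simpa [e, hm] using congrFun h m
    · simpa [e] using congrFun h i
    · have := congrFun h i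
      by_cases hil : i = l
      · rw [hil]
      · simp [e, hil] at this
  rw [← Fintype.sum_of_injective e he (fun o => g (e o)) g ?_ (fun _ => rfl)]
  · simp only [Fintype.sum_option, e]
    ring
  · intro j hj
    apply hg
    · refine Nat.pos_of_ne_zero fun h => hj ⟨none, ?_⟩
      funext l
      have := (Finset.sum_eq_zero_iff.1 h) l (Finset.mem_univ _)
      exact (Fin.ext this).symm
    · rw [sum_coe_fin_two_eq_card]
      by_contra hlt
      have hle : (Finset.univ.filter fun i => j i = 0).card ≤ 1 := by omega
      have : Nonempty (Fin t) := ⟨⟨0, by omega⟩⟩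
      rw [Finset.card_le_one_iff_subset_singleton] at hle
      have ne0 : ∀ b : Fin 2, b ≠ 0 → b = 1 := by decide
      obtain ⟨i, hi⟩ := hle
      by_cases h0 : j i = 0
      · refine hj ⟨some (some i), funext fun l => ?_⟩
        by_cases hl : l = i
        · simp [e, hl, h0]
        · simp only [e, hl, if_false]
          refine (ne0 _ fun h => hl ?_).symm
          simpa using hi (Finset.mem_filter.2 ⟨Finset.mem_univ _, h⟩)
      · refine hj ⟨some none, funext fun l => (ne0 _ fun h => h0 ?_).symm⟩
        have : l = i := by simpa using hi (Finset.mem_filter.2 ⟨Finset.mem_univ l, h⟩)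
        rwa [← this]

/-- The columns of the constraint `aQ ≥ 0` when `a` is supported on weights `0`, `t - 1`, `t`. The
character attached to the all-ones vector takes the value `(-1) ^ |k|` at `k`, and removing the
coordinate `i` from it multiplies this value by `(-1) ^ k i = 1 - 2 * k i`. -/
theorem vecMul_eq_of_support {t : ℕ} (ht : 2 ≤ t) (a : (Fin t → Fin 2) → ℝ)
    (h0 : a (fun _ => 0) = 1)
    (ha : ∀ j, 0 < ∑ i, (j i : ℕ) → ∑ i, (j i : ℕ) < t - 1 → a j = 0) (k : Fin t → Fin 2) :
    Matrix.vecMul a (sumRankSecondEigenmatrix 2 (fun _ : Fin t => 1) (fun _ : Fin t => 1)) k =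
      1 + (-1) ^ (∑ l, (k l : ℕ)) * (a (fun _ => 1) +
        ∑ i, a (fun l => if l = i then 0 else 1) * (1 - 2 * ((k i : ℕ) : ℝ))) := by
  have hQ : ∀ j : Fin t → Fin 2,
      sumRankSecondEigenmatrix 2 (fun _ : Fin t => 1) (fun _ : Fin t => 1) j k =
        ∏ i, if j i = 1 then (-1 : ℝ) ^ (k i : ℕ) else 1 := by
    intro j
    simp only [sumRankSecondEigenmatrix, Matrix.of_apply]
    refine Finset.prod_congr rfl fun i _ => ?_
    rw [← neg_one_pow_fin_two]
    exact bilSecondEigenmatrix_two_one _ _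
  have hone : ∀ i, (∏ l, if (if l = i then (0 : Fin 2) else 1) = 1 then (-1 : ℝ) ^ (k l : ℕ) else 1)
      = (-1) ^ (∑ l, (k l : ℕ)) * (1 - 2 * ((k i : ℕ) : ℝ)) := by
    intro i
    have hl : ∀ l, (if (if l = i then (0 : Fin 2) else 1) = 1 then (-1 : ℝ) ^ (k l : ℕ) else 1) =
        (-1) ^ (k l : ℕ) * (if l = i then (-1) ^ (k i : ℕ) else 1) := by
      intro l
      by_cases h : l = i
      · subst h
        simp [← mul_pow]
      · simp [h]
    rw [Finset.prod_congr rfl fun l _ => hl l, Finset.prod_mul_distrib, Finset.prod_pow_eq_pow_sum,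
      neg_one_pow_fin_two]
    simp
  have key : Matrix.vecMul a
      (sumRankSecondEigenmatrix 2 (fun _ : Fin t => 1) (fun _ : Fin t => 1)) k =
      ∑ j : Fin t → Fin 2, a j * ∏ i, if j i = 1 then (-1 : ℝ) ^ (k i : ℕ) else 1 := by
    simp only [Matrix.vecMul, dotProduct]
    exact Finset.sum_congr rfl fun j _ => by rw [hQ j]
  rw [key, sum_eq_of_support ht _ fun j h1 h2 => by rw [ha j h1 h2, zero_mul]]
  simp only [hone, h0, if_true, Finset.prod_pow_eq_pow_sum]
  simp only [zero_ne_one, if_false, Finset.prod_const_one, mul_add, Finset.mul_sum]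
  rw [← add_assoc]
  congr 1
  · ring
  · exact Finset.sum_congr rfl fun i _ => by ring

theorem sum_ite_one_zero_fin_two {t : ℕ} (i : Fin t) :
    ∑ l, (((if l = i then 0 else 1 : Fin 2)) : ℕ) = t - 1 := by
  rw [sum_coe_fin_two_eq_card]
  simp [Finset.filter_eq']

theorem sum_ite_zero_one_fin_two {t : ℕ} (i : Fin t) :
    ∑ l, (((if l = i then 1 else 0 : Fin 2)) : ℕ) = 1 := by
  rw [Finset.sum_eq_single i] <;> simp +contextual

theorem extremalLPValue_of_even {t : ℕ} (h : Even t) :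
    extremalLPValue t = 2 + 2 / ((t : ℝ) - 1) := if_pos h

theorem extremalLPValue_of_odd {t : ℕ} (h : ¬ Even t) :
    extremalLPValue t = 2 + 2 / ((t : ℝ) - 2) := if_neg h

/-- Weak duality for Delsarte's LP. With `A` and `B` the total mass at weights `t - 1` and `t`, the
sum of the constraints at the weight-one columns gives `t * (1 - B - A) + 2 * A ≥ 0`; the second
constraint is the all-ones column for even `t`, and the sum of the columns of weight `t - 1` for
odd `t`. -/
theorem delsarte_sum_le {t : ℕ} (ht : 2 ≤ t) (a : (Fin t → Fin 2) → ℝ)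
    (ha : DelsarteFeasible 2 (fun _ : Fin t => 1) (fun _ : Fin t => 1) (t - 1) a) :
    ∑ j, a j ≤ extremalLPValue t := by
  obtain ⟨hQ, -, h0, hz⟩ := ha
  have hcol := fun k : Fin t → Fin 2 => (hQ k).trans_eq (vecMul_eq_of_support ht a h0 hz k)
  rw [sum_eq_of_support ht a hz]
  rw [show a (fun _ => 0) = 1 from h0]
  set b : Fin t → ℝ := fun i => a (fun l => if l = i then 0 else 1) with hb
  change ∀ k : Fin t → Fin 2, 0 ≤ 1 + (-1) ^ (∑ l, (k l : ℕ)) * (a (fun _ => 1) +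
        ∑ i, b i * (1 - 2 * ((k i : ℕ) : ℝ))) at hcol
  change _ + ∑ i, b i ≤ _
  set B := a fun _ => 1
  set A := ∑ i, b i with hA
  have htR : (2 : ℝ) ≤ t := by exact_mod_cast ht
  have h1 : ∀ i, 0 ≤ 1 - (B + (A - 2 * b i)) := by
    intro i
    refine (hcol fun l => if l = i then 1 else 0).trans_eq ?_
    rw [sum_ite_zero_one_fin_two]
    have : ∀ l, b l * (1 - 2 * (((if l = i then 1 else 0 : Fin 2) : ℕ) : ℝ)) =
        b l - 2 * (if l = i then b i else 0) := by
      intro l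
      by_cases h : l = i
      · subst h; simp; ring
      · simp [h]
    simp only [this, Finset.sum_sub_distrib, ← Finset.mul_sum]
    simp
    ring
  have h1' : 0 ≤ t * (1 - B - A) + 2 * A := by
    refine (Finset.sum_nonneg fun i (_ : i ∈ Finset.univ) => h1 i).trans_eq ?_
    have : ∀ i, 1 - (B + (A - 2 * b i)) = (1 - B - A) + 2 * b i := fun i => by ring
    simp only [this, Finset.sum_add_distrib, ← Finset.mul_sum, ← hA]
    simp
    ring
  by_cases he : Even t
  · rw [extremalLPValue_of_even he]
    have h2 := hcol fun _ => 1
    have h2' : 0 ≤ 1 + B - A := by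
      refine h2.trans_eq ?_
      simp [he.neg_one_pow, mul_sub, Finset.sum_sub_distrib, ← Finset.sum_mul, ← hA]
      ring
    have : (2 : ℝ) + 2 / (t - 1) = 2 * t / (t - 1) := by
      have : (t : ℝ) - 1 ≠ 0 := by linarith
      field_simp; ring
    rw [this, le_div_iff₀ (by linarith)]
    nlinarith
  · have ht3 : 3 ≤ t := by
      rcases Nat.lt_or_ge 2 t with h | h
      · exact h
      · exact absurd (by rw [le_antisymm h ht]; decide) he
    have htR3 : (3 : ℝ) ≤ t := by exact_mod_cast ht3
    have hpow : (-1 : ℝ) ^ (t - 1) = 1 :=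
      Even.neg_one_pow (Nat.Odd.sub_odd (Nat.not_even_iff_odd.1 he) odd_one)
    rw [extremalLPValue_of_odd he]
    have h2 : ∀ i, 0 ≤ 1 + B - A + 2 * b i := by
      intro i
      refine (hcol fun l => if l = i then 0 else 1).trans_eq ?_
      rw [sum_ite_one_zero_fin_two, hpow]
      have : ∀ l, b l * (1 - 2 * (((if l = i then 0 else 1 : Fin 2) : ℕ) : ℝ)) =
          2 * (if l = i then b i else 0) - b l := by
        intro l
        by_cases h : l = i
        · subst h; simp; ring
        · simp [h]; ring
      simp only [this, Finset.sum_sub_distrib, ← Finset.mul_sum, ← hA]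
      simp
      ring
    have h2' : 0 ≤ t * (1 + B - A) + 2 * A := by
      refine (Finset.sum_nonneg fun i (_ : i ∈ Finset.univ) => h2 i).trans_eq ?_
      simp only [Finset.sum_add_distrib, ← Finset.mul_sum, ← hA]
      simp
      ring
    have : (2 : ℝ) + 2 / (t - 2) = 1 + t / (t - 2) := by
      have : (t : ℝ) - 2 ≠ 0 := by linarith
      field_simp; ring
    rw [this, add_assoc, add_le_add_iff_left, le_div_iff₀ (by linarith)]
    nlinarith

/-- The vector on `{0,1}^t` that depends only on the weight, with value `1` at weight `0`, `α` at
weight `t - 1`, `β` at weight `t`, and `0` elsewhere. -/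
noncomputable def weightVector (t : ℕ) (α β : ℝ) (j : Fin t → Fin 2) : ℝ :=
  if ∑ i, (j i : ℕ) = 0 then 1 else if ∑ i, (j i : ℕ) = t - 1 then α
    else if ∑ i, (j i : ℕ) = t then β else 0

theorem sum_coe_fin_two_le {t : ℕ} (k : Fin t → Fin 2) : ∑ i, (k i : ℕ) ≤ t := by
  rw [sum_coe_fin_two_eq_card]; exact Nat.sub_le _ _

/-- For a vector depending only on the weight, the constraint at a column depends only on the weight
`w` of that column. -/
theorem weightVector_isFeasible {t : ℕ} (ht : 2 ≤ t) {α β : ℝ} (hα : 0 ≤ α) (hβ : 0 ≤ β)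
    (h : ∀ w : ℕ, w ≤ t → 0 ≤ 1 + (-1) ^ w * (β + α * (t - 2 * w))) :
    DelsarteFeasible 2 (fun _ : Fin t => 1) (fun _ : Fin t => 1) (t - 1) (weightVector t α β) ∧
      ∑ j, weightVector t α β j = 1 + β + t * α := by
  have h0 : weightVector t α β (fun _ => 0) = 1 := by simp [weightVector]
  have h1 : weightVector t α β (fun _ => 1) = β := by
    have h1 : t ≠ 0 := by omega
    have h2 : t ≠ t - 1 := by omega
    simp [weightVector, h1, h2]
  have hi : ∀ i, weightVector t α β (fun l => if l = i then 0 else 1) = α := by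
    intro i
    have h1 : t - 1 ≠ 0 := by omega
    rw [weightVector, sum_ite_one_zero_fin_two, if_neg h1, if_pos rfl]
  have hz : ∀ j : Fin t → Fin 2, 0 < ∑ i, (j i : ℕ) → ∑ i, (j i : ℕ) < t - 1 →
      weightVector t α β j = 0 := by
    intro j h1 h2
    rw [weightVector, if_neg h1.ne', if_neg h2.ne, if_neg (by omega)]
  refine ⟨⟨fun k => ?_, fun j => ?_, h0, hz⟩, ?_⟩
  · refine (h (∑ l, ((k l : Fin 2) : ℕ)) (sum_coe_fin_two_le (t := t) k)).trans_eq ?_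
    refine Eq.trans ?_ (vecMul_eq_of_support ht (weightVector t α β) h0 hz k).symm
    simp only [h1, hi, ← Finset.mul_sum, Finset.sum_sub_distrib]
    simp
  · unfold weightVector
    split_ifs <;> first | assumption | norm_num
  · rw [sum_eq_of_support ht _ hz]
    simp [h0, h1, hi]

theorem isGreatest_hammingDelsarteValues {t : ℕ} (ht : 2 ≤ t) :
    IsGreatest (hammingDelsarteValues 2 t (t - 1)) (extremalLPValue t) := by
  refine ⟨?_, ?_⟩
  swap
  · rintro _ ⟨a, ha, rfl⟩
    exact delsarte_sum_le ht a ha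
  have htR : (2 : ℝ) ≤ t := by exact_mod_cast ht
  by_cases he : Even t
  · have ht1 : (0 : ℝ) < t - 1 := by linarith
    obtain ⟨hf, hs⟩ := weightVector_isFeasible ht (α := 1 / ((t : ℝ) - 1)) (β := 1 / ((t : ℝ) - 1))
      (by positivity) (by positivity) (by
        intro w hw
        have hwR : (w : ℝ) ≤ t := by exact_mod_cast hw
        have : ∀ c : ℝ, 1 + c * (1 / ((t : ℝ) - 1) + 1 / ((t : ℝ) - 1) * (t - 2 * w)) =
          ((t - 1) + c * (t + 1 - 2 * w)) / (t - 1) := by intro c; field_simp; ring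
        rw [this]
        apply div_nonneg _ ht1.le
        rcases Nat.even_or_odd w with hw' | hw'
        · rw [hw'.neg_one_pow]; linarith
        · have : (1 : ℝ) ≤ w := by exact_mod_cast hw'.pos
          rw [hw'.neg_one_pow]; linarith)
    refine ⟨_, hf, hs.trans ?_⟩
    rw [extremalLPValue_of_even he]
    field_simp; ring
  · have ht3 : 3 ≤ t := by
      rcases Nat.lt_or_ge 2 t with h | h
      · exact h
      · exact absurd (by rw [le_antisymm h ht]; decide) he
    have ht2 : (0 : ℝ) < t - 2 := by
      have : (3 : ℝ) ≤ t := by exact_mod_cast ht3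
      linarith
    obtain ⟨hf, hs⟩ := weightVector_isFeasible ht (α := 1 / ((t : ℝ) - 2)) (β := 0)
      (by positivity) le_rfl (by
        intro w hw
        have : ∀ c : ℝ, 1 + c * (0 + 1 / ((t : ℝ) - 2) * (t - 2 * w)) =
          ((t - 2) + c * (t - 2 * w)) / (t - 2) := by intro c; field_simp; ring
        rw [this]
        apply div_nonneg _ ht2.le
        rcases Nat.even_or_odd w with hw' | hw'
        · have : w ≠ t := fun h => he (h ▸ hw')
          have : (w : ℝ) + 1 ≤ t := by exact_mod_cast lt_of_le_of_ne hw this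
          rw [hw'.neg_one_pow]; linarith
        · have : (1 : ℝ) ≤ w := by exact_mod_cast hw'.pos
          rw [hw'.neg_one_pow]; linarith)
    refine ⟨_, hf, hs.trans ?_⟩
    rw [extremalLPValue_of_odd he]
    field_simp; ring

/-! ### The spectrum of the hypercube -/

/-- The character table of `𝔽₂^t`: the entry at `(x, k)` is `(-1) ^ ⟨x, k⟩`, written as a product
over the coordinates. -/
noncomputable def cubeCharacter (t : ℕ) : Matrix (Fin t → ZMod 2) (Fin t → ZMod 2) ℝ :=
  Matrix.of fun x k => ∏ i, if x i = 1 ∧ k i = 1 then -1 else 1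

theorem cubeCharacter_mul_self (t : ℕ) :
    cubeCharacter t * cubeCharacter t = (2 : ℝ) ^ t • (1 : Matrix _ _ ℝ) := by
  have hb : ∀ a b : ZMod 2, ∑ c : ZMod 2, (if a = 1 ∧ c = 1 then (-1 : ℝ) else 1) *
      (if c = 1 ∧ b = 1 then -1 else 1) = if a = b then 2 else 0 := by
    have hu : (Finset.univ : Finset (ZMod 2)) = {0, 1} := rfl
    have h01 : ∀ a : ZMod 2, a = 0 ∨ a = 1 := by decide
    intro a b
    rw [hu]
    rcases h01 a with rfl | rfl <;> rcases h01 b with rfl | rfl <;> norm_num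
  ext x y
  simp only [Matrix.mul_apply, cubeCharacter, Matrix.of_apply, ← Finset.prod_mul_distrib]
  rw [← Fintype.piFinset_univ, ← Finset.prod_univ_sum (fun _ => Finset.univ)
    fun i c => (if x i = 1 ∧ c = 1 then (-1 : ℝ) else 1) * (if c = 1 ∧ y i = 1 then -1 else 1)]
  simp only [hb, Matrix.smul_apply, Matrix.one_apply, smul_eq_mul]
  by_cases h : x = y
  · simp [h]
  · obtain ⟨i, hi⟩ := Function.ne_iff.1 h
    rw [if_neg h, mul_zero]
    exact Finset.prod_eq_zero (Finset.mem_univ i) (if_neg hi)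

theorem hammingGraph_neighborFinset (t : ℕ) (x : Fin t → ZMod 2) :
    (hammingGraph t (ZMod 2)).neighborFinset x =
      Finset.univ.image fun i => Function.update x i (x i + 1) := by
  have hne : ∀ a b : ZMod 2, a ≠ b → b = a + 1 := by decide
  ext y
  rw [SimpleGraph.mem_neighborFinset]
  change hammingDist x y = 1 ↔ _
  simp only [hammingDist, Finset.card_eq_one, Finset.mem_image, Finset.mem_univ, true_and]
  refine exists_congr fun i => ⟨fun h => ?_, fun h => ?_⟩
  · have hm : ∀ l, x l ≠ y l ↔ l = i := fun l => by simpa using Finset.ext_iff.1 h l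
    funext l
    by_cases hl : l = i
    · subst hl
      simpa using (hne _ _ ((hm l).2 rfl)).symm
    · rw [Function.update_of_ne hl]
      exact not_not.1 fun h' => hl ((hm l).1 h')
  · subst h
    ext l
    by_cases hl : l = i
    · subst hl
      simp
    · simp [hl]

/-- Characters are eigenvectors of the hypercube: flipping coordinate `i` multiplies the character
indexed by `k` by `(-1) ^ k i`, so the eigenvalue is `∑ i, (-1) ^ k i = t - 2 * |k|`. -/
theorem adjMatrix_mul_cubeCharacter (t : ℕ) :
    (hammingGraph t (ZMod 2)).adjMatrix ℝ * cubeCharacter t =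
      cubeCharacter t * Matrix.diagonal fun k => (t : ℝ) - 2 * hammingNorm k := by
  ext x k
  rw [SimpleGraph.adjMatrix_mul_apply, Matrix.mul_diagonal, hammingGraph_neighborFinset,
    Finset.sum_image]
  swap
  · intro i _ l _ h
    by_contra hil
    have := congrFun h i
    simp [Function.update_of_ne hil] at this
  have hflip : ∀ i, cubeCharacter t (Function.update x i (x i + 1)) k =
      cubeCharacter t x k * if k i ≠ 0 then -1 else 1 := by
    intro i
    have hb : ∀ a b : ZMod 2, (if a + 1 = 1 ∧ b = 1 then (-1 : ℝ) else 1) =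
        (if a = 1 ∧ b = 1 then (-1 : ℝ) else 1) * if b ≠ 0 then -1 else 1 := by
      intro a b
      have h2 : (1 : ZMod 2) + 1 = 0 := rfl
      have h01 : ∀ a : ZMod 2, a = 0 ∨ a = 1 := by decide
      rcases h01 a with rfl | rfl <;> rcases h01 b with rfl | rfl <;> simp [h2]
    simp only [cubeCharacter, Matrix.of_apply]
    rw [← Finset.mul_prod_erase _ _ (Finset.mem_univ i),
      ← Finset.mul_prod_erase Finset.univ (fun i => if x i = 1 ∧ k i = 1 then (-1 : ℝ) else 1)
        (Finset.mem_univ i), Function.update_self, hb]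
    rw [Finset.prod_congr rfl (g := fun i => if x i = 1 ∧ k i = 1 then (-1 : ℝ) else 1)]
    · ring
    · intro l hl
      rw [Function.update_of_ne (Finset.ne_of_mem_erase hl)]
  simp only [hflip, ← Finset.mul_sum]
  congr 1
  have : ∀ i, (if k i ≠ 0 then (-1 : ℝ) else 1) = 1 - 2 * if k i ≠ 0 then 1 else 0 := by
    intro i; split_ifs <;> norm_num
  simp only [this, Finset.sum_sub_distrib, ← Finset.mul_sum, Finset.sum_boole]
  simp [hammingNorm]

theorem adjEigenvalues_hammingGraph (t : ℕ) :
    adjEigenvalues (hammingGraph t (ZMod 2)) =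
      (Finset.univ : Finset (Fin t → ZMod 2)).val.map fun k => (t : ℝ) - 2 * hammingNorm k := by
  have hs : cubeCharacter t * (((2 : ℝ) ^ t)⁻¹ • cubeCharacter t) = 1 := by
    rw [Matrix.mul_smul, cubeCharacter_mul_self, smul_smul, inv_mul_cancel₀ (by positivity),
      one_smul]
  have hA : (hammingGraph t (ZMod 2)).adjMatrix ℝ = cubeCharacter t *
      ((Matrix.diagonal fun k => (t : ℝ) - 2 * hammingNorm k) *
        (((2 : ℝ) ^ t)⁻¹ • cubeCharacter t)) := by
    rw [← mul_assoc, ← adjMatrix_mul_cubeCharacter, mul_assoc, hs, mul_one]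
  rw [adjEigenvalues, hA, Matrix.charpoly_mul_comm, mul_assoc, mul_eq_one_comm.1 hs, mul_one,
    Matrix.charpoly_diagonal, Polynomial.roots_prod _ _
      (Finset.prod_ne_zero_iff.2 fun k _ => Polynomial.X_sub_C_ne_zero _)]
  simp only [Polynomial.roots_X_sub_C, Multiset.bind_singleton]

theorem card_hammingNorm_eq (t j : ℕ) :
    (Finset.univ.filter fun k : Fin t → ZMod 2 => hammingNorm k = j).card = t.choose j := by
  have hne : ∀ a : ZMod 2, a ≠ 0 → a = 1 := by decide
  have : t.choose j = (Finset.powersetCard j (Finset.univ : Finset (Fin t))).card := by simp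
  rw [this]
  refine Finset.card_nbij' (fun k => Finset.univ.filter fun i => k i ≠ 0)
    (fun s i => if i ∈ s then 1 else 0) ?_ ?_ ?_ ?_
  · intro k hk
    simpa [Finset.mem_powersetCard, hammingNorm] using hk
  · intro s hs
    simpa [Finset.mem_powersetCard, hammingNorm] using hs
  · intro k _
    funext i
    by_cases h : k i = 0
    · simp [h]
    · simp [hne _ h]
  · intro s _
    ext i
    simp

theorem eigenvalueMultiplicity_hammingGraph (t j : ℕ) :
    eigenvalueMultiplicity (hammingGraph t (ZMod 2)) ((t : ℝ) - 2 * j) = t.choose j := by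
  rw [eigenvalueMultiplicity, adjEigenvalues_hammingGraph, Multiset.count_map,
    ← card_hammingNorm_eq t j, Finset.card_def, Finset.filter_val]
  congr 1
  refine Multiset.filter_congr fun k _ => ?_
  rw [sub_right_inj, mul_right_inj' two_ne_zero, Nat.cast_inj, eq_comm]

theorem toFinset_adjEigenvalues_hammingGraph (t : ℕ) :
    (adjEigenvalues (hammingGraph t (ZMod 2))).toFinset =
      ((List.range (t + 1)).map fun j : ℕ => (t : ℝ) - 2 * j).toFinset := by
  ext θ
  rw [Multiset.mem_toFinset, List.mem_toFinset, adjEigenvalues_hammingGraph]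
  simp only [Multiset.mem_map, Finset.mem_val, Finset.mem_univ, true_and, List.mem_map,
    List.mem_range]
  constructor
  · rintro ⟨k, rfl⟩
    refine ⟨hammingNorm k, Nat.lt_succ_of_le ?_, rfl⟩
    simpa using hammingNorm_le_card_fintype (x := k)
  · rintro ⟨j, hj, rfl⟩
    have : 0 < (Finset.univ.filter fun k : Fin t → ZMod 2 => hammingNorm k = j).card := by
      rw [card_hammingNorm_eq]
      exact Nat.choose_pos (Nat.le_of_lt_succ hj)
    obtain ⟨k, hk⟩ := Finset.card_pos.1 this
    exact ⟨k, by rw [(Finset.mem_filter.1 hk).2]⟩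

theorem pairwise_gt_hammingEigenvalues (t : ℕ) :
    ((List.range (t + 1)).map fun j : ℕ => (t : ℝ) - 2 * j).Pairwise (· > ·) := by
  rw [List.pairwise_map]
  refine List.pairwise_lt_range.imp fun {a b} h => ?_
  have : (a : ℝ) < b := by exact_mod_cast h
  linarith

theorem numDistinctEigenvalues_hammingGraph (t : ℕ) :
    numDistinctEigenvalues (hammingGraph t (ZMod 2)) = t + 1 := by
  rw [numDistinctEigenvalues, toFinset_adjEigenvalues_hammingGraph,
    List.toFinset_card_of_nodup ((pairwise_gt_hammingEigenvalues t).imp fun h => ne_of_gt h)]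
  simp

theorem distinctEigenvalue_hammingGraph {t j : ℕ} (hj : j ≤ t) :
    distinctEigenvalue (hammingGraph t (ZMod 2)) j = t - 2 * j := by
  have hp := pairwise_gt_hammingEigenvalues t
  rw [distinctEigenvalue, toFinset_adjEigenvalues_hammingGraph,
    (List.toFinset_sort (r := (· ≥ ·)) (hp.imp fun h => ne_of_gt h)).2 (hp.imp fun h => le_of_lt h),
    List.getD_eq_getElem _ _ (by simpa using Nat.lt_succ_of_le hj)]
  simp

/-! ### The Ratio-type LP of the hypercube -/

/-- On the equally spaced nodes `t - 2 * j`, divided differences are rescaled iterated forward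
differences. -/
theorem newtonDivDiff_eq_fwdDiff {t : ℕ} {θ : ℕ → ℝ} (hθ : ∀ j ≤ t, θ j = t - 2 * j) (x : ℕ → ℝ)
    (k : ℕ) : ∀ i, i + k ≤ t →
      newtonDivDiff θ x i k = (fwdDiff 1)^[k] x i / ((-2) ^ k * (k.factorial : ℝ)) := by
  induction k with
  | zero => intro i _; simp [newtonDivDiff]
  | succ k ih =>
    intro i hi
    rw [newtonDivDiff, ih i (by omega), ih (i + 1) (by omega), hθ _ hi, hθ i (by omega),
      Function.iterate_succ_apply', fwdDiff, Nat.factorial_succ]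
    have hk : (k : ℝ) + 1 ≠ 0 := by positivity
    have hf : (k.factorial : ℝ) ≠ 0 := by positivity
    have h2 : ((-2 : ℝ)) ^ k ≠ 0 := pow_ne_zero _ (by norm_num)
    have e : ((t : ℝ) - 2 * ((i + (k + 1) : ℕ) : ℝ)) - (t - 2 * i) = (-2) * (k + 1) := by
      push_cast; ring
    rw [e]
    push_cast
    rw [pow_succ]
    field_simp

theorem newtonDivDiff_eq_zero_iff {t : ℕ} {θ : ℕ → ℝ} (hθ : ∀ j ≤ t, θ j = t - 2 * j) (x : ℕ → ℝ)
    {s : ℕ} (hs : s ≤ t) :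
    newtonDivDiff θ x 0 s = 0 ↔
      ∑ k ∈ Finset.range (s + 1), (-1 : ℝ) ^ k * ((s.choose k : ℝ) * x k) = 0 := by
  rw [newtonDivDiff_eq_fwdDiff hθ x s 0 (by omega), div_eq_zero_iff, or_iff_left
    (mul_ne_zero (pow_ne_zero _ (by norm_num)) (by positivity)), fwdDiff_iter_eq_sum_shift]
  have : ∑ k ∈ Finset.range (s + 1), ((-1 : ℤ) ^ (s - k) * (s.choose k : ℤ)) • x (0 + k • 1) =
      (-1) ^ s * ∑ k ∈ Finset.range (s + 1), (-1 : ℝ) ^ k * ((s.choose k : ℝ) * x k) := by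
    rw [Finset.mul_sum]
    refine Finset.sum_congr rfl fun k hk => ?_
    have hk : k ≤ s := Nat.le_of_lt_succ (Finset.mem_range.1 hk)
    have hsign : (-1 : ℝ) ^ (s - k) = (-1) ^ s * (-1) ^ k := by
      rw [← pow_add, show s + k = (s - k) + 2 * k by omega, pow_add]
      simp
    simp only [zsmul_eq_mul, smul_eq_mul, mul_one, zero_add]
    push_cast
    rw [hsign]
    ring
  rw [this, mul_eq_zero, or_iff_right (pow_ne_zero _ (by norm_num))]

/-- The constraints of the Ratio-type LP for `d = t - 1` in terms of `y k = t.choose k * x k`: they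
say that the alternating moments of order `0` and `1` of `y` vanish. The second one comes from the
divided difference of order `t - 1` through `t * (t-1).choose k = t.choose k * (t - k)`. -/
theorem ratioTypeFeasible_hammingGraph_iff {t : ℕ} (ht : 2 ≤ t) (x : ℕ → ℝ) :
    RatioTypeFeasible (hammingGraph t (ZMod 2)) (t - 1) x ↔
      (∑ k ∈ Finset.range (t + 1), (-1 : ℝ) ^ k * ((t.choose k : ℝ) * x k) = 0 ∧
        ∑ k ∈ Finset.range (t + 1), (-1 : ℝ) ^ k * (k * ((t.choose k : ℝ) * x k)) = 0) ∧
      (∀ j, 1 ≤ j → j ≤ t → 0 ≤ x j) ∧ x 0 = 1 := by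
  have hθ : ∀ j ≤ t, distinctEigenvalue (hammingGraph t (ZMod 2)) j = t - 2 * j :=
    fun j hj => distinctEigenvalue_hammingGraph hj
  rw [RatioTypeFeasible, numDistinctEigenvalues_hammingGraph]
  refine and_congr ?_ (and_congr (by simp only [Nat.lt_succ_iff]) Iff.rfl)
  have hss : (∀ s, t - 1 ≤ s → s < t + 1 →
      newtonDivDiff (distinctEigenvalue (hammingGraph t (ZMod 2))) x 0 s = 0) ↔
      newtonDivDiff (distinctEigenvalue (hammingGraph t (ZMod 2))) x 0 t = 0 ∧
      newtonDivDiff (distinctEigenvalue (hammingGraph t (ZMod 2))) x 0 (t - 1) = 0 := by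
    refine ⟨fun h => ⟨h t (by omega) (by omega), h (t - 1) le_rfl (by omega)⟩, ?_⟩
    rintro ⟨h1, h2⟩ s hs hs'
    obtain rfl | rfl : s = t ∨ s = t - 1 := by omega
    exacts [h1, h2]
  rw [hss, newtonDivDiff_eq_zero_iff hθ x le_rfl, newtonDivDiff_eq_zero_iff hθ x (Nat.sub_le t 1)]
  refine and_congr_right fun h0 => ?_
  obtain ⟨n, rfl⟩ : ∃ n, t = n + 1 := ⟨t - 1, by omega⟩
  have hchoose : ∀ k ∈ Finset.range (n + 1), ((n : ℝ) + 1) * (n.choose k : ℝ) =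
      ((n + 1).choose k : ℝ) * (n + 1 - k) := by
    intro k hk
    have hk : k ≤ n + 1 := (Finset.mem_range.1 hk).le
    have h := congrArg (Nat.cast : ℕ → ℝ) (Nat.choose_mul_succ_eq n k)
    push_cast [Nat.cast_sub hk] at h
    rw [mul_comm, h]
  have key : ((n : ℝ) + 1) * ∑ k ∈ Finset.range (n + 1), (-1 : ℝ) ^ k * ((n.choose k : ℝ) * x k) =
      -∑ k ∈ Finset.range (n + 1 + 1), (-1 : ℝ) ^ k * (k * (((n + 1).choose k : ℝ) * x k)) := by
    calc _ = ∑ k ∈ Finset.range (n + 1),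
          (-1 : ℝ) ^ k * ((((n + 1).choose k : ℝ) * (n + 1 - k)) * x k) := by
          rw [Finset.mul_sum]
          refine Finset.sum_congr rfl fun k hk => ?_
          rw [← hchoose k hk]
          ring
      _ = ∑ k ∈ Finset.range (n + 1 + 1),
          (-1 : ℝ) ^ k * ((((n + 1).choose k : ℝ) * (n + 1 - k)) * x k) := by
          rw [Finset.sum_range_succ _ (n + 1)]
          simp
      _ = ((n : ℝ) + 1) * ∑ k ∈ Finset.range (n + 1 + 1),
            (-1 : ℝ) ^ k * (((n + 1).choose k : ℝ) * x k) -
          ∑ k ∈ Finset.range (n + 1 + 1), (-1 : ℝ) ^ k * (k * (((n + 1).choose k : ℝ) * x k)) := by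
          rw [Finset.mul_sum, ← Finset.sum_sub_distrib]
          exact Finset.sum_congr rfl fun k _ => by ring
      _ = _ := by rw [h0]; ring
  have hn : (n : ℝ) + 1 ≠ 0 := by positivity
  rw [Nat.add_sub_cancel, ← mul_right_inj' hn, key, mul_zero, neg_eq_zero]

theorem ratioTypeObjective_hammingGraph (t : ℕ) (x : ℕ → ℝ) :
    ratioTypeObjective (hammingGraph t (ZMod 2)) x =
      ∑ k ∈ Finset.range (t + 1), (t.choose k : ℝ) * x k := by
  rw [ratioTypeObjective, numDistinctEigenvalues_hammingGraph]
  refine Finset.sum_congr rfl fun k hk => ?_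
  rw [distinctEigenvalue_hammingGraph (Nat.le_of_lt_succ (Finset.mem_range.1 hk)),
    eigenvalueMultiplicity_hammingGraph]

/-- The optimum of the Ratio-type LP in terms of the largest even number `M ≤ t`. It is attained when
`y k = t.choose k * x k` is supported on `k = 0, 1, M`. -/
theorem isLeast_ratioTypeValues_of_even {t M : ℕ} (hM2 : 2 ≤ M) (hMt : M ≤ t) (hM : Even M)
    (hmax : ∀ k ≤ t, Even k → k ≤ M) :
    IsLeast (ratioTypeValues (hammingGraph t (ZMod 2)) (t - 1)) (2 + 2 / ((M : ℝ) - 1)) := by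
  have ht : 2 ≤ t := hM2.trans hMt
  have hMR : (0 : ℝ) < M - 1 := by
    have : (2 : ℝ) ≤ M := by exact_mod_cast hM2
    linarith
  constructor
  · let z : ℕ → ℝ := fun k => (if k = 0 then 1 else 0) + (if k = 1 then M / ((M : ℝ) - 1) else 0) +
      (if k = M then 1 / ((M : ℝ) - 1) else 0)
    have hz : ∀ g : ℕ → ℝ, ∑ k ∈ Finset.range (t + 1), g k * z k =
        g 0 + g 1 * (M / ((M : ℝ) - 1)) + g M * (1 / ((M : ℝ) - 1)) := by
      intro g
      have h1 : t ≠ 0 := by omega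
      simp only [z, mul_add, Finset.sum_add_distrib, mul_ite, mul_zero, Finset.sum_ite_eq',
        Finset.mem_range, Nat.lt_succ_iff, hMt]
      simp [h1]
    have hx : ∀ k ∈ Finset.range (t + 1), (t.choose k : ℝ) * (z k / t.choose k) = z k := by
      intro k hk
      have : (t.choose k : ℝ) ≠ 0 :=
        Nat.cast_ne_zero.2 (Nat.choose_pos (Nat.le_of_lt_succ (Finset.mem_range.1 hk))).ne'
      field_simp
    refine ⟨fun k => z k / t.choose k, ?_, ?_⟩
    · rw [ratioTypeFeasible_hammingGraph_iff ht]
      refine ⟨⟨?_, ?_⟩, fun j _ _ => ?_, ?_⟩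
      · rw [Finset.sum_congr rfl fun k hk => by rw [hx k hk], hz, hM.neg_one_pow]
        field_simp
        ring
      · rw [Finset.sum_congr rfl fun k hk => by rw [hx k hk, ← mul_assoc],
          hz fun k => (-1) ^ k * (k : ℝ), hM.neg_one_pow]
        field_simp
        simp
      · have : 0 ≤ z j := by
          simp only [z]
          positivity
        positivity
      · have : 0 ≠ M := by omega
        simp [z, this]
    · rw [ratioTypeObjective_hammingGraph, Finset.sum_congr rfl hx]
      have := hz fun _ => 1
      simp only [one_mul] at this
      rw [this]
      field_simp
      ring
  · rintro _ ⟨x, hx, rfl⟩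
    rw [ratioTypeFeasible_hammingGraph_iff ht] at hx
    obtain ⟨⟨h0, h1⟩, hpos, hx0⟩ := hx
    rw [ratioTypeObjective_hammingGraph]
    set y : ℕ → ℝ := fun k => (t.choose k : ℝ) * x k with hy
    change ∑ k ∈ Finset.range (t + 1), (-1 : ℝ) ^ k * y k = 0 at h0
    change ∑ k ∈ Finset.range (t + 1), (-1 : ℝ) ^ k * (k * y k) = 0 at h1
    change _ ≤ ∑ k ∈ Finset.range (t + 1), y k
    -- Adding multiples of the two vanishing moments to the objective, chosen so that the
    -- coefficients at `k = 1` and `k = M` become zero, makes all coefficients with `1 ≤ k ≤ t`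
    -- nonnegative and the coefficient at `0` equal to the optimum.
    have hcomb : ∑ k ∈ Finset.range (t + 1), y k = ∑ k ∈ Finset.range (t + 1),
        (1 + (-1) ^ k * ((M + 1 - 2 * k) / ((M : ℝ) - 1))) * y k := by
      have : ∀ k ∈ Finset.range (t + 1),
          (1 + (-1) ^ k * ((M + 1 - 2 * k) / ((M : ℝ) - 1))) * y k =
          y k + (M + 1) / ((M : ℝ) - 1) * ((-1) ^ k * y k) -
            2 / ((M : ℝ) - 1) * ((-1) ^ k * (k * y k)) := by
        intro k _
        field_simp
        ring
      rw [Finset.sum_congr rfl this, Finset.sum_sub_distrib, Finset.sum_add_distrib,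
        ← Finset.mul_sum, ← Finset.mul_sum, h0, h1]
      ring
    rw [hcomb]
    have hterm : ∀ k ∈ Finset.range (t + 1), 1 ≤ k →
        0 ≤ (1 + (-1) ^ k * ((M + 1 - 2 * k) / ((M : ℝ) - 1))) * y k := by
      intro k hk hk1
      have hkt := Nat.le_of_lt_succ (Finset.mem_range.1 hk)
      refine mul_nonneg ?_ (mul_nonneg (Nat.cast_nonneg _) (hpos k hk1 hkt))
      have : ∀ c : ℝ, 1 + c * ((M + 1 - 2 * k) / ((M : ℝ) - 1)) =
          ((M - 1) + c * (M + 1 - 2 * k)) / ((M : ℝ) - 1) := by intro c; field_simp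
      rw [this]
      apply div_nonneg _ hMR.le
      rcases Nat.even_or_odd k with hk' | hk'
      · have : (k : ℝ) ≤ M := by exact_mod_cast hmax k hkt hk'
        rw [hk'.neg_one_pow]
        linarith
      · have : (1 : ℝ) ≤ k := by exact_mod_cast hk1
        rw [hk'.neg_one_pow]
        linarith
    rw [Finset.sum_range_succ']
    have htail : 0 ≤ ∑ k ∈ Finset.range t,
        (1 + (-1) ^ (k + 1) * ((M + 1 - 2 * ((k + 1 : ℕ) : ℝ)) / ((M : ℝ) - 1))) * y (k + 1) :=
      Finset.sum_nonneg fun k hk => hterm (k + 1)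
        (Finset.mem_range.2 (Nat.succ_lt_succ (Finset.mem_range.1 hk))) (Nat.succ_pos k)
    have hhead : (1 + (-1) ^ 0 * ((M + 1 - 2 * ((0 : ℕ) : ℝ)) / ((M : ℝ) - 1))) * y 0 =
        2 + 2 / ((M : ℝ) - 1) := by
      simp [hy, hx0]
      field_simp
      ring
    rw [hhead]
    linarith

theorem isLeast_ratioTypeValues {t : ℕ} (ht : 2 ≤ t) :
    IsLeast (ratioTypeValues (hammingGraph t (ZMod 2)) (t - 1)) (extremalLPValue t) := by
  by_cases he : Even t
  · rw [extremalLPValue_of_even he]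
    exact isLeast_ratioTypeValues_of_even ht le_rfl he fun k hk _ => hk
  · have ho := Nat.not_even_iff_odd.1 he
    have h2 : t ≠ 2 := fun h => he (h ▸ even_two)
    have hv : extremalLPValue t = 2 + 2 / (((t - 1 : ℕ) : ℝ) - 1) := by
      rw [extremalLPValue_of_odd he, Nat.cast_sub (by omega)]
      congr 2
      push_cast
      ring
    rw [hv]
    refine isLeast_ratioTypeValues_of_even (by omega) (by omega) (Nat.Odd.sub_odd ho odd_one) ?_
    intro k hk hke
    have : k ≠ t := fun h => he (h ▸ hke)
    omega

/-! ### Comparison with the Singleton bound -/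

theorem floor_extremalLPValue {t : ℕ} (ht : 4 ≤ t) : ⌊extremalLPValue t⌋ = 2 := by
  have h4 : (4 : ℝ) ≤ t := by exact_mod_cast ht
  have hfloor : ∀ c : ℝ, 2 < c → ⌊(2 : ℝ) + 2 / c⌋ = 2 := by
    intro c hc
    rw [Int.floor_eq_iff]
    have h1 : 0 ≤ 2 / c := by positivity
    have h2 : 2 / c < 1 := (div_lt_one (by linarith)).2 hc
    push_cast
    constructor <;> linarith
  by_cases he : Even t
  · rw [extremalLPValue_of_even he]
    exact hfloor _ (by linarith)
  · have h5 : t ≠ 4 := fun h => he (h ▸ by decide)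
    have h5 : (5 : ℝ) ≤ t := by exact_mod_cast (show 5 ≤ t by omega)
    rw [extremalLPValue_of_odd he]
    exact hfloor _ (by linarith)

theorem mainTheorem3 (t : ℕ) (ht : 2 ≤ t) :
    IsGreatest (hammingDelsarteValues 2 t (t - 1)) (extremalLPValue t) ∧
    IsLeast (ratioTypeValues (hammingGraph t (ZMod 2)) (t - 1)) (extremalLPValue t) ∧
    (4 ≤ t → ⌊extremalLPValue t⌋ = 2 ∧ hammingSingletonBound 2 t (t - 1) = 4) := by
  refine ⟨isGreatest_hammingDelsarteValues ht, isLeast_ratioTypeValues ht,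
    fun h4 => ⟨floor_extremalLPValue h4, ?_⟩⟩
  rw [hammingSingletonBound, show t - (t - 1) + 1 = 2 by omega]
  rfl
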